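/- Let $G$ be a finite perfect group, i.e. $G$ equals its derived subgroup $G'$. Let $G = H\cdot K$ be a decomposition of $G$ into direct factors, i.e. $H$ and $K$ are normal subgroups of $G$ with $G = HK$ and $H\cap K = 1$. Let $H_0 \trianglelefteq G$ be a normal subgroup such that $H_0 \cong H$ and $G/H_0 \cong K$. Then $H_0$ is a direct factor of $G$: there exists a normal subgroup $K_0 \trianglelefteq G$ such that $G = H_0K_0$ and $H_0\cap K_0 = 1$. -/

import Mathlib

/-- `G = H.K` is a decomposition of `G` into direct factors: `H` and `K` are normal subgroups of
`G`, `H ∩ K = 1`, and every element of `G` is a product of an element of `H` and an element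
of `K`. -/
structure IsDirectDecomposition {G : Type*} [Group G] (H K : Subgroup G) : Prop where
  normal_left : H.Normal
  normal_right : K.Normal
  inf_eq_bot : H ⊓ K = ⊥
  exists_mul_eq : ∀ g : G, ∃ h ∈ H, ∃ k ∈ K, h * k = g

/-- `H` is a direct factor of `G`. -/
def IsDirectFactor {G : Type*} [Group G] (H : Subgroup G) : Prop :=
  ∃ K : Subgroup G, IsDirectDecomposition H K

/-! Write N for `H₀`. The hypotheses make G abstractly isomorphic to N × G/N, and two counts turn
this into a statement about N itself. Commuting families: the count is multiplicative on products,
while for any normal N the pairs over a given pair of G/N are at most as many as those inside N. The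
abstract isomorphism forces equality in every fibre. For the family listing all of N, this says that
C(N) meets every coset of N, so G = N·C(N). Direct factors: N is perfect, so a direct factor A of G
has traces N ∩ A and AN/N that are direct factors of N and G/N. Since G = N·C(N) is perfect, these
traces determine A. The abstract product gives G at least as many direct factors as there are pairs
of traces, so every pair occurs; the pair (N, 1) comes only from N. -/

/-- The number of pairs formed by a family in `G` indexed by `ι` and an element of `G` commuting
with all members of the family. -/
noncomputable def cardCommutingFamilies (ι G : Type*) [Group G] : ℕ :=
  Nat.card {p : (ι → G) × G // ∀ i, Commute (p.1 i) p.2}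

theorem cardCommutingFamilies_congr (ι : Type*) {G G' : Type*} [Group G] [Group G']
    (e : G ≃* G') : cardCommutingFamilies ι G = cardCommutingFamilies ι G' := by
  refine Nat.card_congr (Equiv.subtypeEquiv
    ((Equiv.piCongrRight fun _ => e.toEquiv).prodCongr e.toEquiv) fun p => ?_)
  refine forall_congr' fun i => ?_
  simp only [commute_iff_eq]
  rw [← e.injective.eq_iff]
  simp

theorem cardCommutingFamilies_prod (ι G G' : Type*) [Group G] [Group G'] :
    cardCommutingFamilies ι (G × G') =
      cardCommutingFamilies ι G * cardCommutingFamilies ι G' := by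
  unfold cardCommutingFamilies
  rw [← Nat.card_prod]
  refine Nat.card_congr
    { toFun := fun p => (⟨(fun i => (p.1.1 i).1, p.1.2.1), fun i => ((Prod.commute_iff).1 (p.2 i)).1⟩,
        ⟨(fun i => (p.1.1 i).2, p.1.2.2), fun i => ((Prod.commute_iff).1 (p.2 i)).2⟩)
      invFun := fun p => ⟨(fun i => (p.1.1.1 i, p.2.1.1 i), (p.1.1.2, p.2.1.2)),
        fun i => Prod.commute_iff.2 ⟨p.1.2 i, p.2.2 i⟩⟩
      left_inv := fun p => rfl
      right_inv := fun p => rfl }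

/-- A coset of the kernel of a homomorphism meets a subgroup in at most as many elements as the
kernel does. -/
theorem Subgroup.card_filter_map_eq_le {Γ Q : Type*} [Group Γ] [Fintype Γ] [Group Q]
    (S : Subgroup Γ) (f : Γ →* Q) (q : Q) [DecidablePred fun s => s ∈ S ∧ f s = q]
    [DecidablePred fun s => s ∈ S ∧ f s = 1] :
    (Finset.univ.filter fun s => s ∈ S ∧ f s = q).card ≤
      (Finset.univ.filter fun s => s ∈ S ∧ f s = 1).card := by
  rcases (Finset.univ.filter fun s => s ∈ S ∧ f s = q).eq_empty_or_nonempty with h | ⟨t, ht⟩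
  · simp [h]
  · simp only [Finset.mem_filter, Finset.mem_univ, true_and] at ht
    refine Finset.card_le_card_of_injOn (fun s => t⁻¹ * s) ?_ (mul_right_injective _).injOn
    intro s hs
    simp only [Finset.coe_filter, Finset.mem_univ, true_and, Set.mem_ofPred_eq] at hs ⊢
    exact ⟨S.mul_mem (S.inv_mem ht.1) hs.1, by simp [hs.2, ht.2]⟩

/-- The elements commuting with all members of a family. -/
def familyCentralizer {ι G : Type*} [Group G] (x : ι → G) : Subgroup G :=
  Subgroup.centralizer (Set.range x)

theorem mem_familyCentralizer {ι G : Type*} [Group G] {x : ι → G} {c : G} :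
    c ∈ familyCentralizer x ↔ ∀ i, Commute (x i) c := by
  simp [familyCentralizer, Subgroup.mem_centralizer_iff, commute_iff_eq]

/-! ### Commuting families over a quotient -/

section Counting

variable {G : Type*} [Group G] [Fintype G] (N : Subgroup G) {ι : Type*} [Fintype ι]

open Classical in
/-- The commuting pairs in `G` lying over a given pair in the quotient. -/
noncomputable def commutingLifts (x : ι → G ⧸ N) (c : G ⧸ N) : Finset ((ι → G) × G) :=
  Finset.univ.filter fun p => (∀ i, Commute (p.1 i) p.2) ∧
    (∀ i, (p.1 i : G ⧸ N) = x i) ∧ (p.2 : G ⧸ N) = c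

theorem mem_commutingLifts {x : ι → G ⧸ N} {c : G ⧸ N} {p : (ι → G) × G} :
    p ∈ commutingLifts N x c ↔ (∀ i, Commute (p.1 i) p.2) ∧
      (∀ i, (p.1 i : G ⧸ N) = x i) ∧ (p.2 : G ⧸ N) = c := by
  simp [commutingLifts]

variable [N.Normal]

open Classical in
theorem card_commutingLifts_eq_sum (x : ι → G ⧸ N) (c : G ⧸ N) :
    (commutingLifts N x c).card =
      ∑ y ∈ Finset.univ.filter (fun y : ι → G => ∀ i, (y i : G ⧸ N) = x i),
        (Finset.univ.filter fun s => s ∈ familyCentralizer y ∧ QuotientGroup.mk' N s = c).card := by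
  rw [Finset.card_eq_sum_card_fiberwise (f := Prod.fst)
    (t := Finset.univ.filter (fun y : ι → G => ∀ i, (y i : G ⧸ N) = x i))]
  · refine Finset.sum_congr rfl fun y hy => ?_
    refine Finset.card_bij' (fun p _ => p.2) (fun s _ => (y, s)) ?_ ?_ ?_ ?_
    · rintro ⟨y', s⟩ h
      simp only [Finset.mem_filter, mem_commutingLifts] at h
      obtain ⟨⟨h1, -, h3⟩, rfl⟩ := h
      simpa [mem_familyCentralizer] using ⟨h1, h3⟩
    · intro s hs
      simp only [Finset.mem_filter, Finset.mem_univ, true_and, mem_familyCentralizer] at hs hy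
      simpa [mem_commutingLifts] using ⟨hs.1, hy, hs.2⟩
    · rintro ⟨y', s⟩ h
      simp only [Finset.mem_filter] at h
      simp [h.2]
    · simp
  · intro p hp
    simp only [Finset.mem_coe, mem_commutingLifts] at hp
    simpa using hp.2.1

open Classical in
theorem card_commutingLifts_eq_sum_right (x : ι → G ⧸ N) (c : G ⧸ N) :
    (commutingLifts N x c).card =
      ∑ s ∈ Finset.univ.filter (fun s : G => (s : G ⧸ N) = c),
        (Finset.univ.filter fun y : ι → G =>
          y ∈ Subgroup.pi Set.univ (fun _ => Subgroup.centralizer {s}) ∧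
            (QuotientGroup.mk' N).compLeft ι y = x).card := by
  rw [Finset.card_eq_sum_card_fiberwise (f := Prod.snd)
    (t := Finset.univ.filter (fun s : G => (s : G ⧸ N) = c))]
  · refine Finset.sum_congr rfl fun s hs => ?_
    refine Finset.card_bij' (fun p _ => p.1) (fun y _ => (y, s)) ?_ ?_ ?_ ?_
    · rintro ⟨y, s'⟩ h
      simp only [Finset.mem_filter, mem_commutingLifts] at h
      obtain ⟨⟨h1, h2, -⟩, rfl⟩ := h
      simp only [Finset.mem_filter, Finset.mem_univ, true_and, Subgroup.mem_pi,
        Subgroup.mem_centralizer_singleton_iff]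
      exact ⟨fun i _ => (h1 i).eq, funext h2⟩
    · intro y hy
      simp only [Finset.mem_filter, Finset.mem_univ, true_and, Subgroup.mem_pi,
        Subgroup.mem_centralizer_singleton_iff] at hy hs
      simp only [Finset.mem_filter, mem_commutingLifts, and_true]
      exact ⟨fun i => hy.1 i trivial, fun i => congrFun hy.2 i, hs⟩
    · rintro ⟨y', s⟩ h
      simp only [Finset.mem_filter] at h
      simp [h.2]
    · simp
  · intro p hp
    simp only [Finset.mem_coe, mem_commutingLifts] at hp
    simpa using hp.2.2

/-- One coordinate moves to the identity at a time. With the family y fixed, the second entries lie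
in a coset of N cut by C(y); with the element s fixed, the families lie in a coset of the kernel cut
by the power of C(s). -/
theorem card_commutingLifts_le (x : ι → G ⧸ N) (c : G ⧸ N) :
    (commutingLifts N x c).card ≤ (commutingLifts N (1 : ι → G ⧸ N) 1).card := by
  classical
  trans (commutingLifts N x 1).card
  · rw [card_commutingLifts_eq_sum, card_commutingLifts_eq_sum]
    exact Finset.sum_le_sum fun y _ => Subgroup.card_filter_map_eq_le _ _ _
  · rw [card_commutingLifts_eq_sum_right, card_commutingLifts_eq_sum_right]
    exact Finset.sum_le_sum fun y _ => Subgroup.card_filter_map_eq_le _ _ _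

theorem card_commutingLifts_one_le :
    (commutingLifts N (1 : ι → G ⧸ N) 1).card ≤ cardCommutingFamilies ι N := by
  classical
  rw [cardCommutingFamilies, ← Nat.card_eq_finsetCard]
  refine Nat.card_le_card_of_injective
    (fun p => ⟨(fun i => ⟨p.1.1 i, ?_⟩, ⟨p.1.2, ?_⟩), fun i => Subtype.ext ?_⟩) ?_
  · exact (QuotientGroup.eq_one_iff _).1 (((mem_commutingLifts N).1 p.2).2.1 i)
  · exact (QuotientGroup.eq_one_iff _).1 ((mem_commutingLifts N).1 p.2).2.2
  · exact ((mem_commutingLifts N).1 p.2).1 i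
  · rintro ⟨⟨x, c⟩, hp⟩ ⟨⟨y, d⟩, hq⟩ h
    exact Subtype.ext (Prod.ext
      (funext fun i => congrArg (fun p => (p.1.1 i : G)) h) (congrArg (fun p => (p.1.2 : G)) h))

open Classical in
theorem cardCommutingFamilies_eq_sum :
    cardCommutingFamilies ι G =
      ∑ p ∈ Finset.univ.filter (fun p : (ι → G ⧸ N) × (G ⧸ N) => ∀ i, Commute (p.1 i) p.2),
        (commutingLifts N p.1 p.2).card := by
  rw [cardCommutingFamilies, Nat.card_eq_fintype_card, Fintype.card_subtype,
    Finset.card_eq_sum_card_fiberwise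
      (f := fun p : (ι → G) × G => ((fun i => (p.1 i : G ⧸ N)), (p.2 : G ⧸ N)))
      (t := Finset.univ.filter
        (fun p : (ι → G ⧸ N) × (G ⧸ N) => ∀ i, Commute (p.1 i) p.2))]
  · refine Finset.sum_congr rfl fun q _ => congrArg Finset.card ?_
    ext p
    simp [mem_commutingLifts, Prod.ext_iff, funext_iff]
  · intro p hp
    simp only [Finset.coe_filter, Finset.mem_univ, true_and, Set.mem_ofPred_eq] at hp ⊢
    exact fun i => (hp i).map (QuotientGroup.mk' N)

/-- If commuting families are as numerous in `G` as in `N × G ⧸ N`, then every element of `G` is,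
up to an element of `N`, in the centralizer of `N`. -/
theorem sup_centralizer_eq_top_of_card
    (h : cardCommutingFamilies N G =
      cardCommutingFamilies N N * cardCommutingFamilies N (G ⧸ N)) :
    N ⊔ Subgroup.centralizer (N : Set G) = ⊤ := by
  classical
  have hle := card_commutingLifts_le (ι := N) N
  have heq := (Finset.sum_eq_sum_iff_of_le
    (s := Finset.univ.filter (fun p : (N → G ⧸ N) × (G ⧸ N) => ∀ i, Commute (p.1 i) p.2))
    (f := fun p => (commutingLifts N p.1 p.2).card)
    (g := fun _ => (commutingLifts N (1 : N → G ⧸ N) 1).card) fun p _ => hle _ _).1 <| by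
      refine le_antisymm (Finset.sum_le_sum fun p _ => hle _ _) ?_
      have hsum := cardCommutingFamilies_eq_sum (ι := N) N
      refine le_of_le_of_eq ?_ (hsum.trans (by congr!))
      rw [h, Finset.sum_const, smul_eq_mul, mul_comm,
        cardCommutingFamilies.eq_1 N (G ⧸ N), Nat.card_eq_fintype_card, Fintype.card_subtype]
      exact Nat.mul_le_mul_right _ (card_commutingLifts_one_le N)
  rw [eq_top_iff]
  intro g _
  have h1 := heq (1, (g : G ⧸ N)) (by simp)
  rw [card_commutingLifts_eq_sum, card_commutingLifts_eq_sum, Finset.sum_eq_sum_iff_of_le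
    fun y _ => Subgroup.card_filter_map_eq_le _ _ _] at h1
  -- The tautological family lies over 1 and its centralizer is C(N). Its fibre over gN is as large
  -- as the one over 1, which contains 1.
  have h2 := h1 (fun n : N => (n : G)) (by simp)
  have h3 : 0 < (Finset.univ.filter fun s => s ∈ familyCentralizer (fun n : N => (n : G)) ∧
      QuotientGroup.mk' N s = 1).card :=
    Finset.card_pos.2 ⟨1, by simp [one_mem]⟩
  rw [← h2, Finset.card_pos] at h3
  obtain ⟨c, hc⟩ := h3
  simp only [Finset.mem_filter, Finset.mem_univ, true_and, mem_familyCentralizer,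
    QuotientGroup.mk'_apply] at hc
  have hcg : c⁻¹ * g ∈ N := QuotientGroup.eq.1 hc.2
  have hcC : c ∈ Subgroup.centralizer (N : Set G) :=
    Subgroup.mem_centralizer_iff.2 fun n hn => hc.1 ⟨n, hn⟩
  rw [← mul_inv_cancel_left c g]
  exact mul_mem (Subgroup.mem_sup_right hcC) (Subgroup.mem_sup_left hcg)

end Counting

/-! ### Direct factors and their traces on M and G/M -/

section DirectFactors

variable {G : Type*} [Group G]

theorem IsDirectDecomposition.sup_eq_top {A B : Subgroup G} (h : IsDirectDecomposition A B) :
    A ⊔ B = ⊤ := by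
  rw [eq_top_iff]
  intro g _
  obtain ⟨a, ha, b, hb, rfl⟩ := h.exists_mul_eq g
  exact Subgroup.mul_mem_sup ha hb

/-- The isomorphism of `A × B` with `G` for a direct decomposition. -/
theorem IsDirectDecomposition.nonempty_mulEquiv {A B : Subgroup G}
    (h : IsDirectDecomposition A B) : Nonempty (A × B ≃* G) := by
  have hA := h.normal_left
  have hB := h.normal_right
  have hd : Disjoint A B := disjoint_iff.2 h.inf_eq_bot
  have hc : ∀ (a : A) (b : B), Commute (A.subtype a) (B.subtype b) := fun a b =>
    Subgroup.commute_of_normal_of_disjoint A B hA hB hd a b a.2 b.2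
  refine ⟨MulEquiv.ofBijective (MonoidHom.noncommCoprod A.subtype B.subtype hc) ⟨?_, ?_⟩⟩
  · rw [MonoidHom.noncommCoprod_injective]
    exact ⟨A.subtype_injective, B.subtype_injective, by simpa using hd⟩
  · intro g
    obtain ⟨a, ha, b, hb, rfl⟩ := h.exists_mul_eq g
    exact ⟨(⟨a, ha⟩, ⟨b, hb⟩), rfl⟩

theorem IsDirectDecomposition.map_mulEquiv {G' : Type*} [Group G'] (e : G ≃* G')
    {A B : Subgroup G} (h : IsDirectDecomposition A B) :
    IsDirectDecomposition (A.map e.toMonoidHom) (B.map e.toMonoidHom) := by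
  refine ⟨h.normal_left.map _ e.surjective, h.normal_right.map _ e.surjective, ?_, fun g => ?_⟩
  · rw [← Subgroup.map_inf _ _ _ e.injective, h.inf_eq_bot, Subgroup.map_bot]
  · obtain ⟨a, ha, b, hb, hab⟩ := h.exists_mul_eq (e.symm g)
    exact ⟨e a, ⟨a, ha, rfl⟩, e b, ⟨b, hb, rfl⟩, by rw [← map_mul, hab, e.apply_symm_apply]⟩

theorem IsDirectFactor.map_mulEquiv {G' : Type*} [Group G'] (e : G ≃* G') {A : Subgroup G}
    (h : IsDirectFactor A) : IsDirectFactor (A.map e.toMonoidHom) :=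
  let ⟨_, hB⟩ := h
  ⟨_, hB.map_mulEquiv e⟩

theorem card_isDirectFactor_le_of_mulEquiv {G' : Type*} [Group G'] [Finite G'] (e : G ≃* G') :
    Nat.card {A : Subgroup G // IsDirectFactor A} ≤
      Nat.card {A : Subgroup G' // IsDirectFactor A} :=
  Nat.card_le_card_of_injective (fun A => ⟨_, A.2.map_mulEquiv e⟩) fun _ _ h =>
    Subtype.ext (Subgroup.map_injective e.injective (congrArg Subtype.val h))

theorem IsDirectFactor.prod {G' : Type*} [Group G'] {A : Subgroup G} {A' : Subgroup G'}
    (h : IsDirectFactor A) (h' : IsDirectFactor A') : IsDirectFactor (A.prod A') := by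
  obtain ⟨B, hB⟩ := h
  obtain ⟨B', hB'⟩ := h'
  have := hB.normal_left
  have := hB.normal_right
  have := hB'.normal_left
  have := hB'.normal_right
  refine ⟨B.prod B', inferInstance, inferInstance, ?_, ?_⟩
  · rw [eq_bot_iff]
    rintro ⟨x, y⟩ ⟨⟨h1, h2⟩, ⟨h3, h4⟩⟩
    have hx : x ∈ A ⊓ B := ⟨h1, h3⟩
    have hy : y ∈ A' ⊓ B' := ⟨h2, h4⟩
    rw [hB.inf_eq_bot, Subgroup.mem_bot] at hx
    rw [hB'.inf_eq_bot, Subgroup.mem_bot] at hy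
    simp [hx, hy]
  · rintro ⟨x, y⟩
    obtain ⟨a, ha, b, hb, rfl⟩ := hB.exists_mul_eq x
    obtain ⟨a', ha', b', hb', rfl⟩ := hB'.exists_mul_eq y
    exact ⟨(a, a'), ⟨ha, ha'⟩, (b, b'), ⟨hb, hb'⟩, rfl⟩

theorem card_isDirectFactor_mul_le (G G' : Type*) [Group G] [Group G'] [Finite G] [Finite G'] :
    Nat.card {A : Subgroup G // IsDirectFactor A} *
      Nat.card {A : Subgroup G' // IsDirectFactor A} ≤
      Nat.card {A : Subgroup (G × G') // IsDirectFactor A} := by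
  rw [← Nat.card_prod]
  refine Nat.card_le_card_of_injective (fun p => ⟨_, p.1.2.prod p.2.2⟩) ?_
  rintro ⟨⟨A, hA⟩, ⟨A', hA'⟩⟩ ⟨⟨B, hB⟩, ⟨B', hB'⟩⟩ h
  have h : A.prod A' = B.prod B' := congrArg Subtype.val h
  have h1 : A = B := by
    ext x
    simpa [Subgroup.mem_prod] using SetLike.ext_iff.1 h (x, 1)
  have h2 : A' = B' := by
    ext x
    simpa [Subgroup.mem_prod] using SetLike.ext_iff.1 h (1, x)
  subst h1 h2
  rfl

theorem Subgroup.commutator_sup_of_normal (M X Y : Subgroup G) [M.Normal] [X.Normal] [Y.Normal] :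
    ⁅M, X ⊔ Y⁆ = ⁅M, X⁆ ⊔ ⁅M, Y⁆ := by
  refine le_antisymm (commutator_le.2 fun m hm z hz => ?_)
    (sup_le (commutator_mono le_rfl le_sup_left) (commutator_mono le_rfl le_sup_right))
  obtain ⟨x, hx, y, hy, rfl⟩ := Subgroup.mem_sup_of_normal_left.1 hz
  rw [commutatorElement_mul_right_eq_mul_conj, mul_assoc, mul_assoc, ← mul_assoc x]
  exact mul_mem_sup (commutator_mem_commutator hm hx)
    ((commutator_normal M Y).conj_mem _ (commutator_mem_commutator hm hy) x)

/-- A normal subgroup that equals its commutator with the whole group is adapted to every direct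
decomposition. -/
theorem IsDirectDecomposition.inf_eq_commutator {A B M : Subgroup G} [M.Normal]
    (h : IsDirectDecomposition A B) (hM : M ≤ ⁅M, (⊤ : Subgroup G)⁆) : M ⊓ A = ⁅M, A⁆ := by
  have := h.normal_left
  have := h.normal_right
  refine le_antisymm ?_ (Subgroup.commutator_le_inf M A)
  rintro m ⟨hm, hmA⟩
  have hm' := hM hm
  rw [← h.sup_eq_top, Subgroup.commutator_sup_of_normal] at hm'
  obtain ⟨u, hu, v, hv, rfl⟩ := Subgroup.mem_sup_of_normal_left.1 hm'
  have hv1 : v ∈ A ⊓ B :=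
    ⟨(A.mul_mem_cancel_left (Subgroup.commutator_le_right M A hu)).1 hmA,
      Subgroup.commutator_le_right M B hv⟩
  rw [h.inf_eq_bot, Subgroup.mem_bot] at hv1
  simpa [hv1] using hu

theorem IsDirectDecomposition.exists_mul_eq_of_mem {A B M : Subgroup G} [M.Normal]
    (h : IsDirectDecomposition A B) (hM : M ≤ ⁅M, (⊤ : Subgroup G)⁆) {m : G} (hm : m ∈ M) :
    ∃ a ∈ M ⊓ A, ∃ b ∈ M ⊓ B, a * b = m := by
  have := h.normal_left
  have := h.normal_right
  have hm' := hM hm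
  rw [← h.sup_eq_top, Subgroup.commutator_sup_of_normal] at hm'
  obtain ⟨u, hu, v, hv, rfl⟩ := Subgroup.mem_sup_of_normal_left.1 hm'
  exact ⟨u, Subgroup.commutator_le_inf _ _ hu, v, Subgroup.commutator_le_inf _ _ hv, rfl⟩

variable {M : Subgroup G} [M.Normal]

theorem IsDirectFactor.subgroupOf {A : Subgroup G} (h : IsDirectFactor A)
    (hM : M ≤ ⁅M, (⊤ : Subgroup G)⁆) : IsDirectFactor (A.subgroupOf M) := by
  obtain ⟨B, hB⟩ := h
  have := hB.normal_left
  have := hB.normal_right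
  refine ⟨B.subgroupOf M, inferInstance, inferInstance, ?_, fun g => ?_⟩
  · rw [Subgroup.subgroupOf, Subgroup.subgroupOf, ← Subgroup.comap_inf, hB.inf_eq_bot]
    simp
  · obtain ⟨a, ha, b, hb, hab⟩ := hB.exists_mul_eq_of_mem hM g.2
    exact ⟨⟨a, ha.1⟩, ha.2, ⟨b, hb.1⟩, hb.2, Subtype.ext hab⟩

theorem IsDirectFactor.map_mk {A : Subgroup G} (h : IsDirectFactor A)
    (hM : M ≤ ⁅M, (⊤ : Subgroup G)⁆) : IsDirectFactor (A.map (QuotientGroup.mk' M)) := by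
  obtain ⟨B, hB⟩ := h
  refine ⟨B.map (QuotientGroup.mk' M), hB.normal_left.map _ (QuotientGroup.mk'_surjective M),
    hB.normal_right.map _ (QuotientGroup.mk'_surjective M), ?_, fun g => ?_⟩
  · rw [eq_bot_iff]
    rintro _ ⟨⟨a, ha, rfl⟩, ⟨b, hb, hab⟩⟩
    have hmem : a⁻¹ * b ∈ M := QuotientGroup.eq.1 hab.symm
    obtain ⟨a', ha', b', hb', h'⟩ := hB.exists_mul_eq_of_mem hM hmem
    -- Both sides lie in A ∩ B = 1, so a is the inverse of an element of M.
    have h1 : a * a' = b * b'⁻¹ := by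
      rw [eq_mul_inv_iff_mul_eq, mul_assoc, h', mul_inv_cancel_left]
    have h2 : a * a' ∈ A ⊓ B :=
      ⟨mul_mem ha ha'.2, h1 ▸ B.mul_mem hb (B.inv_mem hb'.2)⟩
    rw [hB.inf_eq_bot, Subgroup.mem_bot] at h2
    rw [Subgroup.mem_bot, QuotientGroup.mk'_apply, QuotientGroup.eq_one_iff,
      eq_inv_of_mul_eq_one_left h2]
    exact inv_mem ha'.1
  · obtain ⟨g, rfl⟩ := QuotientGroup.mk'_surjective M g
    obtain ⟨a, ha, b, hb, rfl⟩ := hB.exists_mul_eq g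
    exact ⟨_, ⟨a, ha, rfl⟩, _, ⟨b, hb, rfl⟩, (map_mul _ _ _).symm⟩

/-- A direct factor of a perfect group is recovered from its traces on `M` and on `G ⧸ M`. -/
theorem IsDirectFactor.eq_inf_sup_commutator [Group.IsPerfect G] {A : Subgroup G}
    (h : IsDirectFactor A) (hM : M ≤ ⁅M, (⊤ : Subgroup G)⁆)
    (hC : M ⊔ Subgroup.centralizer (M : Set G) = ⊤) :
    A = (M ⊓ A) ⊔ ⁅Subgroup.centralizer (M : Set G), A ⊔ M⁆ := by
  obtain ⟨B, hB⟩ := h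
  have := hB.normal_left
  have h1 : ⁅Subgroup.centralizer (M : Set G), M⁆ = ⊥ :=
    Subgroup.commutator_eq_bot_iff_le_centralizer.2 le_rfl
  have h2 := hB.inf_eq_commutator (M := ⊤)
    (by rw [← commutator_def, Group.IsPerfect.commutator_eq_top])
  -- The right side becomes [M, A][C(M), A] = [G, A], which is A because G is perfect.
  rw [hB.inf_eq_commutator hM, Subgroup.commutator_sup_of_normal, h1, sup_bot_eq,
    Subgroup.commutator_comm M, Subgroup.commutator_comm _ A, ← Subgroup.commutator_sup_of_normal,
    hC, Subgroup.commutator_comm, ← h2, top_inf_eq]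

theorem isDirectFactor_of_card [Finite G] [Group.IsPerfect G]
    (hM : M ≤ ⁅M, (⊤ : Subgroup G)⁆) (hC : M ⊔ Subgroup.centralizer (M : Set G) = ⊤)
    (hcard : Nat.card {A : Subgroup M // IsDirectFactor A} *
      Nat.card {A : Subgroup (G ⧸ M) // IsDirectFactor A} ≤
      Nat.card {A : Subgroup G // IsDirectFactor A}) : IsDirectFactor M := by
  let φ : {A : Subgroup G // IsDirectFactor A} →
      {A : Subgroup M // IsDirectFactor A} × {A : Subgroup (G ⧸ M) // IsDirectFactor A} :=
    fun A => (⟨_, A.2.subgroupOf hM⟩, ⟨_, A.2.map_mk hM⟩)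
  have hφ : Function.Injective φ := by
    rintro ⟨A, hA⟩ ⟨B, hB⟩ hAB
    have h1 : A.subgroupOf M = B.subgroupOf M := congrArg (fun p => p.1.1) hAB
    have h2 : A.map (QuotientGroup.mk' M) = B.map (QuotientGroup.mk' M) :=
      congrArg (fun p => p.2.1) hAB
    have h3 : M ⊓ A = M ⊓ B := by
      simpa [Subgroup.subgroupOf_inj, inf_comm] using h1
    have h4 : A ⊔ M = B ⊔ M := by
      simpa [Subgroup.map_eq_map_iff] using h2
    exact Subtype.ext (show A = B by
      rw [hA.eq_inf_sup_commutator hM hC, hB.eq_inf_sup_commutator hM hC, h3, h4])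
  have hbij := (Nat.bijective_iff_injective_and_card φ).2 ⟨hφ,
    le_antisymm (Nat.card_le_card_of_injective φ hφ) (by rwa [Nat.card_prod])⟩
  have htop : IsDirectFactor (⊤ : Subgroup M) :=
    ⟨⊥, inferInstance, inferInstance, by simp, fun g => ⟨g, trivial, 1, rfl, mul_one g⟩⟩
  have hbot : IsDirectFactor (⊥ : Subgroup (G ⧸ M)) :=
    ⟨⊤, inferInstance, inferInstance, by simp, fun g => ⟨1, rfl, g, trivial, one_mul g⟩⟩
  -- The first trace gives M ≤ A, the second A ≤ M.
  obtain ⟨⟨A, hA⟩, hA'⟩ := hbij.2 (⟨⊤, htop⟩, ⟨⊥, hbot⟩)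
  have h1 : A.subgroupOf M = ⊤ := congrArg (fun p => p.1.1) hA'
  have h2 : A.map (QuotientGroup.mk' M) = ⊥ := congrArg (fun p => p.2.1) hA'
  rw [Subgroup.subgroupOf_eq_top] at h1
  rw [Subgroup.map_eq_bot_iff, QuotientGroup.ker_mk'] at h2
  rwa [le_antisymm h1 h2]

end DirectFactors

theorem proposition3p2 {G : Type*} [Group G] [Finite G] [Group.IsPerfect G]
    (H K : Subgroup G) (hHK : IsDirectDecomposition H K)
    (H₀ : Subgroup G) [H₀.Normal]
    (hH : Nonempty (H₀ ≃* H)) (hK : Nonempty (G ⧸ H₀ ≃* K)) :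
    IsDirectFactor H₀ := by
  have := Fintype.ofFinite G
  obtain ⟨e⟩ := hHK.nonempty_mulEquiv
  obtain ⟨eH⟩ := hH
  obtain ⟨eK⟩ := hK
  let E : H₀ × (G ⧸ H₀) ≃* G := (eH.prodCongr eK).trans e
  -- Through `E`, `H₀` is a homomorphic image of G.
  have : Group.IsPerfect H₀ :=
    Group.IsPerfect.ofSurjective (f := (MonoidHom.fst H₀ (G ⧸ H₀)).comp E.symm.toMonoidHom)
      (Prod.fst_surjective.comp E.symm.surjective)
  have hM : H₀ ≤ ⁅H₀, (⊤ : Subgroup G)⁆ :=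
    H₀.commutator_eq_self.ge.trans (Subgroup.commutator_mono le_rfl le_top)
  have : Fintype H₀ := Fintype.ofFinite H₀
  have hC := sup_centralizer_eq_top_of_card H₀
    (by rw [← cardCommutingFamilies_congr H₀ E, cardCommutingFamilies_prod])
  exact isDirectFactor_of_card hM hC
    ((card_isDirectFactor_mul_le _ _).trans (card_isDirectFactor_le_of_mulEquiv E))
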